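/- **ZFP round trip.** Fix a dimension $d\ge 1$, a significand length $k\ge 1$ of the floating-point source format, an integer precision $q\ge 0$, and a rounding rule (to nearest, with ties to even or away from zero; toward zero; up; or down). Let $e(v)=\lfloor\log_2 |v|\rfloor$. For a number $\beta$ of bit planes, a block $u\in\mathbb R^{4^d}$ is compressed and decompressed as follows. A zero block is mapped to zero. Otherwise, with $e_u=e(\|u\|_\infty)$: 1. each entry is scaled by $2^{q-1-e_u}$ and truncated toward zero to an integer; 2. the integer implementation (lifting scheme with arithmetic shifts) of the ZFP forward transform, whose exact version is $\frac1{16}\begin{bmatrix}4&4&4&4\\5&1&-1&-5\\-4&4&4&-4\\-2&6&-6&2\end{bmatrix}$, is applied along each of the $d$ dimensions; 3. each coefficient is written in negabinary $\sum_{i=0}^{q+1}c_i(-2)^i$, $c_i\in\{0,1\}$, and the digits $c_i$ with $i<q+2-\beta$ are replaced by $0$ (so the $\beta$ most significant of the $q+2$ bit planes are kept); 4. the integer implementation of the backward transform is applied along the dimensions in reverse order; 5. the result is scaled by $2^{e_u-q+1}$ and rounded to $k$ significant bits. For a $d$-dimensional array $x$, partitioned into non-overlapping blocks of $4^d$ entries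 and identified with a vector in $\mathbb R^n$, let $DC_\beta(x)$ be the array obtained by treating every block in this way. Put $\epsilon_r=2^{1-r}$, $k_{\mathcal T}=\frac74(2^d-1)$ and $$K_\beta=\left(\tfrac{15}{4}\right)^d\left((1+\epsilon_k)\left(\tfrac83\epsilon_\beta+\epsilon_q\left(1+\tfrac83\epsilon_\beta\right)\left(k_{\mathcal T}(1+\epsilon_q)+1\right)\right)+\epsilon_k\right).$$ **Lemma.** Let $g:\mathbb R^n\to\mathbb R^n$ be Lipschitz continuous in $\|\cdot\|_\infty$ with constant $0\le L_l<1$, and let $x_0=y_0$, $y_{s+1}=g(y_s)$, $x_{s+1}=g(DC_{\beta_s}(x_s))$ for $s\ge 0$. Let $t\ge 0$, let $0\le\beta_j\le q-2d+2$ for $0\le j\le t$, and put $\gamma=\max_{0\le j\le t}\|x_j\|_\infty$. Assume $\epsilon\ge \dfrac{K_q\,\gamma}{1-L_l}$, where $K_q$ is $K_\beta$ at $\beta=q$. If a real number $\tilde\beta$ satisfies $$\tilde\beta\ \ge\ 1-\log_2\left(\left(\tfrac{4}{15}\right)^d\frac{3\epsilon(1-L_l)}{8\gamma(2^d+1)L_l(1-L_l^{t+2})}\right)$$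 (no condition if $\gamma L_l=0$) and $\beta_j\ge\tilde\beta$ for $0\le j\le t$, then $$\|x_{t+1}-y_{t+1}\|_\infty\le\epsilon .$$ -/

import Mathlib

open scoped NNReal

noncomputable section

namespace ZFP

/-! The ZFP lossy compressor in fixed-precision mode.  `d` is the dimension of the data, `k` the
number of significand bits of the floating-point source format, `q` the number of bits of the
signed integers of the block-floating-point representation, `β` the number of bit planes kept. -/

/-- The rounding-direction rules of IEEE arithmetic. -/
inductive RoundingMode
  | nearestEven
  | nearestAway
  | towardZero
  | up
  | down

/-- Rounding a real number to an integer under the given rule. -/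
def RoundingMode.round : RoundingMode → ℝ → ℤ
  | .nearestEven, s =>
      if Int.fract s < 1 / 2 then ⌊s⌋
      else if 1 / 2 < Int.fract s then ⌈s⌉
      else if Even ⌊s⌋ then ⌊s⌋ else ⌈s⌉
  | .nearestAway, s =>
      if Int.fract s < 1 / 2 then ⌊s⌋
      else if 1 / 2 < Int.fract s then ⌈s⌉
      else if 0 ≤ s then ⌈s⌉ else ⌊s⌋
  | .towardZero, s => if 0 ≤ s then ⌊s⌋ else ⌈s⌉
  | .up, s => ⌈s⌉
  | .down, s => ⌊s⌋

/-- Rounding a real number to a floating-point number with `k` significand bits (the leading one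
bit included). For `v ≠ 0`, `Int.log 2 |v|` is the exponent `⌊log₂ |v|⌋`. -/
def flRound (rnd : RoundingMode) (k : ℕ) (v : ℝ) : ℝ :=
  if v = 0 then 0
  else (rnd.round (v * 2 ^ ((k : ℤ) - 1 - Int.log 2 |v|)) : ℝ) * 2 ^ (Int.log 2 |v| - ((k : ℤ) - 1))

/-- The positions inside a `d`-dimensional block of `4 ^ d` values. -/
abbrev BlockIdx (d : ℕ) := Fin d → Fin 4

/-- The integer implementation (lifting scheme, `a / 2` is the arithmetic shift `a >> 1`) of the
one-dimensional forward transform, whose exact counterpart is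
`1/16 * [4, 4, 4, 4; 5, 1, -1, -5; -4, 4, 4, -4; -2, 6, -6, 2]`. -/
def fwdLift (p : Fin 4 → ℤ) : Fin 4 → ℤ :=
  let x₁ := (p 0 + p 3) / 2
  let w₁ := p 3 - x₁
  let z₁ := (p 2 + p 1) / 2
  let y₁ := p 1 - z₁
  let x₂ := (x₁ + z₁) / 2
  let z₂ := z₁ - x₂
  let w₂ := (w₁ + y₁) / 2
  let y₂ := y₁ - w₂
  let w₃ := w₂ + y₂ / 2
  let y₃ := y₂ - w₃ / 2
  ![x₂, y₃, z₂, w₃]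

/-- The integer implementation (lifting scheme) of the one-dimensional backward transform, whose
exact counterpart is `1/4 * [4, 6, -4, -1; 4, 2, 4, 5; 4, -2, 4, -5; 4, -6, -4, 1]`. -/
def invLift (p : Fin 4 → ℤ) : Fin 4 → ℤ :=
  let y₁ := p 1 + p 3 / 2
  let w₁ := p 3 - y₁ / 2
  let y₂ := y₁ + w₁
  let w₂ := 2 * w₁ - y₂
  let z₁ := p 2 + p 0
  let x₁ := 2 * p 0 - z₁
  let y₃ := y₂ + z₁
  let z₂ := 2 * z₁ - y₃
  let w₃ := w₂ + x₁
  let x₂ := 2 * x₁ - w₃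
  ![x₂, y₃, z₂, w₃]

/-- Apply a one-dimensional transform along the `i`-th dimension of a block. -/
def along {d : ℕ} (T : (Fin 4 → ℤ) → Fin 4 → ℤ) (i : Fin d) (f : BlockIdx d → ℤ) :
    BlockIdx d → ℤ :=
  fun p => T (fun a => f (Function.update p i a)) (p i)

/-- The forward transform of a block: one pass along each dimension. -/
def fwdTransform {d : ℕ} (f : BlockIdx d → ℤ) : BlockIdx d → ℤ :=
  (List.finRange d).foldl (fun h i => along fwdLift i h) f

/-- The backward transform of a block: one pass along each dimension, in reverse order. -/
def invTransform {d : ℕ} (f : BlockIdx d → ℤ) : BlockIdx d → ℤ :=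
  (List.finRange d).foldr (fun i h => along invLift i h) f

/-- For an integer `z = c₀ + c₁ (-2) + c₂ (-2)² + ⋯` this is `c₁ + c₂ (-2) + ⋯`. -/
def negaShift (z : ℤ) : ℤ := -(z / 2)

/-- The `i`-th digit, `0` or `1`, of the negabinary (base `-2`) representation of an integer. -/
def negaDigit (z : ℤ) (i : ℕ) : ℤ := (negaShift^[i] z) % 2

/-- A compressed block: the common exponent and, for each transform coefficient, `q + 2`
negabinary digits. The permutation of the coefficients and the lossless coding of the bit planes
are undone exactly by decompression and are not represented. -/
structure Compressed (d q : ℕ) where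
  exponent : ℤ
  bit : BlockIdx d → Fin (q + 2) → Bool

/-- The block-floating-point integers of a block with respect to the exponent
`⌊log₂ ‖x‖_∞⌋` of its largest entry: signed integers of at most `q` bits. -/
def blockInts {d : ℕ} (q : ℕ) (x : BlockIdx d → ℝ) : BlockIdx d → ℤ :=
  fun p => RoundingMode.towardZero.round (x p * 2 ^ ((q : ℤ) - 1 - Int.log 2 ‖x‖))

/-- Fixed-precision compression of a block. Of the `q + 2` bit planes, the `β` most significant
ones (indices `i ≥ q + 2 - β`) are kept, the others are replaced by zeros. -/
def compress {d : ℕ} (q β : ℕ) (x : BlockIdx d → ℝ) : Compressed d q where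
  exponent := Int.log 2 ‖x‖
  bit := fun p i =>
    decide (q + 2 ≤ (i : ℕ) + β ∧ negaDigit (fwdTransform (blockInts q x) p) i = 1)

/-- Decompression of a block: evaluate the negabinary digits, apply the backward transform, scale
by the common exponent, and convert to the floating-point format with `k` significand bits. -/
def decompress {d q : ℕ} (rnd : RoundingMode) (k : ℕ) (c : Compressed d q) : BlockIdx d → ℝ :=
  fun p => flRound rnd k
    ((invTransform (fun r => ∑ i : Fin (q + 2), if c.bit r i then (-2 : ℤ) ^ (i : ℕ) else 0) p : ℝ)
      * 2 ^ (c.exponent - ((q : ℤ) - 1)))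

/-- The positions in a `d`-dimensional array that has `m i` blocks, hence `m i * 4` entries, along
its `i`-th dimension. -/
abbrev ArrayIdx {d : ℕ} (m : Fin d → ℕ) := (i : Fin d) → Fin (m i * 4)

/-- The block of the array `x` with block coordinates `b`; its entry at `p` sits at the position
with `i`-th coordinate `4 * b i + p i`. -/
def block {d : ℕ} {m : Fin d → ℕ} (x : ArrayIdx m → ℝ) (b : (i : Fin d) → Fin (m i)) :
    BlockIdx d → ℝ :=
  fun p => x (fun i => finProdFinEquiv (b i, p i))

/-- Compression followed by decompression of a whole array, block by block. -/
def roundTrip {d : ℕ} {m : Fin d → ℕ} (rnd : RoundingMode) (k q β : ℕ) (x : ArrayIdx m → ℝ) :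
    ArrayIdx m → ℝ :=
  fun j => decompress rnd k
    (compress q β (block x fun i => (finProdFinEquiv.symm (j i)).1))
    (fun i => (finProdFinEquiv.symm (j i)).2)

/-- `ε_r = 2 ^ (1 - r)`. -/
def eps (r : ℤ) : ℝ := 2 ^ (1 - r)

/-- `k_T = 7/4 * (2 ^ d - 1)`. -/
def kT (d : ℕ) : ℝ := 7 / 4 * (2 ^ d - 1)

/-- The single-use error constant `K_β`. -/
def K (d k q β : ℕ) : ℝ :=
  (15 / 4) ^ d *
    ((1 + eps k) *
        (8 / 3 * eps β + eps q * (1 + 8 / 3 * eps β) * (kT d * (1 + eps q) + 1)) + eps k)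

end ZFP

end

open scoped NNReal

noncomputable section

namespace ZFP

/-! One round trip has relative error at most `blockError`. Since `β + 2 * d ≤ q + 2`, clearing
digits leaves multiples of `4 ^ d`, on which the integer backward transform is exact
(`foldr_inv_exact`). Its amplification factor `(15/4) ^ d` acts on the negabinary truncation error
and on the rounding of the forward passes, at most `3/2` each; truncation to integers and the final
rounding add the rest (`norm_roundTrip_sub_le`).

`blockError_le` bounds `blockError` by a combination, with weights `1/3` and `2/3`, of `K` at `β =
q` and the quantity controlled by the lower bound on the `β j`. After multiplication by `γ * L * (1
- L ^ (t + 2))`, each of the two is at most `ε * (1 - L)`, hence so is `blockError`. The contraction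
of `g` then turns the one-step bound into a geometric sum (`error_recursion`). -/

/-! ### Rounding errors -/

theorem RoundingMode.abs_round_sub_le (rnd : RoundingMode) (s : ℝ) :
    |(rnd.round s : ℝ) - s| ≤ 1 := by
  have hf : |(⌊s⌋ : ℝ) - s| ≤ 1 := by
    rw [abs_le]; constructor <;> linarith [Int.floor_le s, Int.lt_floor_add_one s]
  have hc : |(⌈s⌉ : ℝ) - s| ≤ 1 := by
    rw [abs_le]; constructor <;> linarith [Int.le_ceil s, Int.ceil_lt_add_one s]
  cases rnd <;> simp only [RoundingMode.round] <;> (try split_ifs) <;> assumption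

theorem abs_round_towardZero_le (s : ℝ) : |(RoundingMode.towardZero.round s : ℝ)| ≤ |s| := by
  simp only [RoundingMode.round]
  split_ifs with h
  · have h1 : (0 : ℝ) ≤ ⌊s⌋ := by exact_mod_cast Int.floor_nonneg.2 h
    rw [abs_of_nonneg h1, abs_of_nonneg h]
    exact Int.floor_le s
  · have h' : s ≤ 0 := (not_le.1 h).le
    have h1 : (⌈s⌉ : ℝ) ≤ 0 := by exact_mod_cast Int.ceil_le.2 (by simpa using h')
    rw [abs_of_nonpos h1, abs_of_nonpos h']
    linarith [Int.le_ceil s]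

theorem abs_flRound_sub_le (rnd : RoundingMode) (k : ℕ) (v : ℝ) :
    |flRound rnd k v - v| ≤ eps k * |v| := by
  unfold flRound
  split_ifs with hv
  · simp [hv]
  set l := Int.log 2 |v|
  have h2 : (v * 2 ^ ((k : ℤ) - 1 - l)) * 2 ^ (l - ((k : ℤ) - 1)) = v := by
    rw [mul_assoc, ← zpow_add₀ (two_ne_zero' ℝ)]
    simp
  have h3 : (2 : ℝ) ^ l ≤ |v| := by
    have := Int.zpow_log_le_self (b := 2) one_lt_two (abs_pos.2 hv)
    exact_mod_cast this
  -- One unit in the last place; directed rounding can lose all of it, hence `eps k` and not half of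
  -- it.
  have h4 : (2 : ℝ) ^ (l - ((k : ℤ) - 1)) = eps k * 2 ^ l := by
    rw [eps, ← zpow_add₀ (two_ne_zero' ℝ)]
    congr 1
    ring
  have h5 : 0 < eps k := by unfold eps; positivity
  have h6 := rnd.abs_round_sub_le (v * 2 ^ ((k : ℤ) - 1 - l))
  nth_rewrite 2 [← h2]
  rw [← sub_mul, abs_mul, abs_of_pos (by positivity : (0 : ℝ) < 2 ^ (l - ((k : ℤ) - 1)))]
  calc _ ≤ 1 * (2 : ℝ) ^ (l - ((k : ℤ) - 1)) := by gcongr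
    _ = eps k * 2 ^ l := by rw [one_mul, h4]
    _ ≤ _ := by gcongr

/-! ### The one-dimensional transforms -/

/-- The matrix of the exact forward transform. -/
def fwdMatrix : Matrix (Fin 4) (Fin 4) ℝ :=
  !![4/16, 4/16, 4/16, 4/16; 5/16, 1/16, -1/16, -5/16; -4/16, 4/16, 4/16, -4/16;
    -2/16, 6/16, -6/16, 2/16]

/-- The matrix of the exact backward transform. -/
def invMatrix : Matrix (Fin 4) (Fin 4) ℝ :=
  !![4/4, 6/4, -4/4, -1/4; 4/4, 2/4, 4/4, 5/4; 4/4, -2/4, 4/4, -5/4; 4/4, -6/4, -4/4, 1/4]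

theorem invMatrix_mul_fwdMatrix : invMatrix * fwdMatrix = 1 := by
  ext i j
  fin_cases i <;> fin_cases j <;>
    simp [invMatrix, fwdMatrix, Matrix.mul_apply, Fin.sum_univ_four] <;> norm_num

theorem fwdMatrix_row_sum (i : Fin 4) : ∑ j, |fwdMatrix i j| ≤ 1 := by
  fin_cases i <;> simp [fwdMatrix, Fin.sum_univ_four, abs_div] <;> norm_num

theorem invMatrix_row_sum (i : Fin 4) : ∑ j, |invMatrix i j| ≤ 15 / 4 := by
  fin_cases i <;> simp [invMatrix, Fin.sum_univ_four, abs_div] <;> norm_num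

theorem two_mul_half_bounds (a : ℤ) : 2 * (a / 2) ≤ a ∧ a ≤ 2 * (a / 2) + 1 := by omega

theorem fwdLift_bounds (p : Fin 4 → ℤ) :
    (|16 * fwdLift p 0 - (4 * p 0 + 4 * p 1 + 4 * p 2 + 4 * p 3)| ≤ 24) ∧
    (|16 * fwdLift p 1 - (5 * p 0 + p 1 - p 2 - 5 * p 3)| ≤ 24) ∧
    (|16 * fwdLift p 2 - (-4 * p 0 + 4 * p 1 + 4 * p 2 - 4 * p 3)| ≤ 24) ∧
    (|16 * fwdLift p 3 - (-2 * p 0 + 6 * p 1 - 6 * p 2 + 2 * p 3)| ≤ 24) := by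
  simp only [abs_le, fwdLift, Matrix.cons_val]
  generalize p 0 = a, p 1 = b, p 2 = c, p 3 = d
  obtain ⟨h1, h1'⟩ := two_mul_half_bounds (a + d)
  generalize (a + d) / 2 = x₁ at *
  obtain ⟨h2, h2'⟩ := two_mul_half_bounds (c + b)
  generalize (c + b) / 2 = z₁ at *
  obtain ⟨h3, h3'⟩ := two_mul_half_bounds (x₁ + z₁)
  generalize (x₁ + z₁) / 2 = x₂ at *
  obtain ⟨h4, h4'⟩ := two_mul_half_bounds (d - x₁ + (b - z₁))
  generalize (d - x₁ + (b - z₁)) / 2 = w₂ at *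
  obtain ⟨h5, h5'⟩ := two_mul_half_bounds (b - z₁ - w₂)
  generalize (b - z₁ - w₂) / 2 = y at *
  obtain ⟨h6, h6'⟩ := two_mul_half_bounds (w₂ + y)
  generalize (w₂ + y) / 2 = w at *
  refine ⟨?_, ?_, ?_, ?_⟩ <;> constructor <;> linarith

theorem abs_fwdLift_sub_le (p : Fin 4 → ℤ) (i : Fin 4) :
    |(fwdLift p i : ℝ) - (fwdMatrix.mulVec fun j => (p j : ℝ)) i| ≤ 3 / 2 := by
  obtain ⟨h0, h1, h2, h3⟩ := fwdLift_bounds p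
  rw [abs_le] at *
  have h0' : ((-24 : ℤ) : ℝ) ≤ _ ∧ _ ≤ ((24 : ℤ) : ℝ) := ⟨Int.cast_le.2 h0.1, Int.cast_le.2 h0.2⟩
  have h1' : ((-24 : ℤ) : ℝ) ≤ _ ∧ _ ≤ ((24 : ℤ) : ℝ) := ⟨Int.cast_le.2 h1.1, Int.cast_le.2 h1.2⟩
  have h2' : ((-24 : ℤ) : ℝ) ≤ _ ∧ _ ≤ ((24 : ℤ) : ℝ) := ⟨Int.cast_le.2 h2.1, Int.cast_le.2 h2.2⟩
  have h3' : ((-24 : ℤ) : ℝ) ≤ _ ∧ _ ≤ ((24 : ℤ) : ℝ) := ⟨Int.cast_le.2 h3.1, Int.cast_le.2 h3.2⟩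
  push_cast at h0' h1' h2' h3'
  fin_cases i <;> simp [Matrix.mulVec, dotProduct, Fin.sum_univ_four, fwdMatrix] <;>
    constructor <;> linarith

theorem half_sum_bounds {M a b : ℤ} (ha : -M ≤ a ∧ a ≤ M) (hb : -M ≤ b ∧ b ≤ M) :
    (-M ≤ (a + b) / 2 ∧ (a + b) / 2 ≤ M) ∧ (-M ≤ b - (a + b) / 2 ∧ b - (a + b) / 2 ≤ M) := by
  omega

/-- `M = 1` is a true exception: `w = -1`, `y = 0` gives the second output `2`. -/
theorem shear_bounds {M w y : ℤ} (hM : M ≠ 1) (hw : -M ≤ w ∧ w ≤ M) (hy : -M ≤ y ∧ y ≤ M) :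
    let w' := (w + y) / 2 + (y - (w + y) / 2) / 2
    (-M ≤ w' ∧ w' ≤ M) ∧ (-M ≤ y - (w + y) / 2 - w' / 2 ∧ y - (w + y) / 2 - w' / 2 ≤ M) := by
  obtain ⟨h4, h4'⟩ := two_mul_half_bounds (w + y)
  generalize (w + y) / 2 = a at *
  obtain ⟨h5, h5'⟩ := two_mul_half_bounds (y - a)
  generalize (y - a) / 2 = b at *
  obtain ⟨h6, h6'⟩ := two_mul_half_bounds (a + b)
  generalize (a + b) / 2 = c at *
  dsimp only
  omega

theorem abs_fwdLift_le {M : ℤ} (hM : M ≠ 1) (p : Fin 4 → ℤ) (hp : ∀ i, |p i| ≤ M) (i : Fin 4) :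
    |fwdLift p i| ≤ M := by
  simp only [abs_le] at *
  obtain ⟨hx, hw⟩ := half_sum_bounds (hp 0) (hp 3)
  obtain ⟨hz, hy⟩ := half_sum_bounds (hp 2) (hp 1)
  obtain ⟨h0, h2⟩ := half_sum_bounds hx hz
  obtain ⟨h3, h1⟩ := shear_bounds hM hw hy
  fin_cases i
  exacts [h0, h1, h2, h3]

/-- The only shifts are `p 3 / 2` and the halving of `p 1 + p 3 / 2`, both exact on multiples of
`4`. -/
theorem four_mul_invLift (p : Fin 4 → ℤ) (hp : ∀ i, 4 ∣ p i) :
    4 * invLift p 0 = 4 * p 0 + 6 * p 1 - 4 * p 2 - p 3 ∧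
    4 * invLift p 1 = 4 * p 0 + 2 * p 1 + 4 * p 2 + 5 * p 3 ∧
    4 * invLift p 2 = 4 * p 0 - 2 * p 1 + 4 * p 2 - 5 * p 3 ∧
    4 * invLift p 3 = 4 * p 0 - 6 * p 1 - 4 * p 2 + p 3 := by
  have p1 := hp 1
  have p3 := hp 3
  simp only [invLift, Matrix.cons_val]
  refine ⟨?_, ?_, ?_, ?_⟩ <;> omega

theorem invLift_eq_mulVec (p : Fin 4 → ℤ) (hp : ∀ i, 4 ∣ p i) (i : Fin 4) :
    (invLift p i : ℝ) = (invMatrix.mulVec fun j => (p j : ℝ)) i := by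
  obtain ⟨h0, h1, h2, h3⟩ := four_mul_invLift p hp
  rify at h0 h1 h2 h3
  fin_cases i <;> simp [Matrix.mulVec, dotProduct, Fin.sum_univ_four, invMatrix] <;> linarith

theorem dvd_invLift (m : ℤ) (p : Fin 4 → ℤ) (hp : ∀ i, 4 * m ∣ p i) (i : Fin 4) :
    m ∣ invLift p i := by
  obtain ⟨h0, h1, h2, h3⟩ := four_mul_invLift p fun j => (Dvd.intro m rfl).trans (hp j)
  choose c hc using hp
  rw [hc 0, hc 1, hc 2, hc 3] at h0 h1 h2 h3
  fin_cases i
  · exact ⟨4 * c 0 + 6 * c 1 - 4 * c 2 - c 3, by simp only [Fin.zero_eta]; linarith⟩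
  · exact ⟨4 * c 0 + 2 * c 1 + 4 * c 2 + 5 * c 3, by simp only [Fin.mk_one]; linarith⟩
  · exact ⟨4 * c 0 - 2 * c 1 + 4 * c 2 - 5 * c 3, by simp only [Fin.reduceFinMk]; linarith⟩
  · exact ⟨4 * c 0 - 6 * c 1 - 4 * c 2 + c 3, by simp only [Fin.reduceFinMk]; linarith⟩

/-! ### Passes along all dimensions -/

/-- Apply a matrix along the `i`-th dimension of a real block. -/
def alongMatrix {d : ℕ} (A : Matrix (Fin 4) (Fin 4) ℝ) (i : Fin d) (f : BlockIdx d → ℝ) :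
    BlockIdx d → ℝ :=
  fun p => A.mulVec (fun a => f (Function.update p i a)) (p i)

variable {d : ℕ}

theorem alongMatrix_sub (A : Matrix (Fin 4) (Fin 4) ℝ) (i : Fin d) (f g : BlockIdx d → ℝ) :
    alongMatrix A i (f - g) = alongMatrix A i f - alongMatrix A i g := by
  funext p
  exact congrFun (A.mulVec_sub (fun a => f (Function.update p i a)) _) (p i)

theorem alongMatrix_alongMatrix {A B : Matrix (Fin 4) (Fin 4) ℝ} (h : B * A = 1) (i : Fin d)
    (f : BlockIdx d → ℝ) : alongMatrix B i (alongMatrix A i f) = f := by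
  funext p
  simp only [alongMatrix, Function.update_self, Function.update_idem]
  change B.mulVec (A.mulVec _) (p i) = _
  rw [Matrix.mulVec_mulVec, h, Matrix.one_mulVec, Function.update_eq_self]

theorem norm_alongMatrix_le {A : Matrix (Fin 4) (Fin 4) ℝ} {C : ℝ}
    (hA : ∀ i, ∑ j, |A i j| ≤ C) (i : Fin d) (f : BlockIdx d → ℝ) :
    ‖alongMatrix A i f‖ ≤ C * ‖f‖ := by
  have hC : 0 ≤ C := (Finset.sum_nonneg fun _ _ => abs_nonneg _).trans (hA 0)
  refine (pi_norm_le_iff_of_nonneg (by positivity)).2 fun p => ?_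
  calc ‖alongMatrix A i f p‖
      ≤ ∑ j, ‖A (p i) j * f (Function.update p i j)‖ :=
        norm_sum_le Finset.univ fun j => A (p i) j * f (Function.update p i j)
    _ ≤ ∑ j, |A (p i) j| * ‖f‖ := by
        refine Finset.sum_le_sum fun j _ => ?_
        rw [norm_mul, Real.norm_eq_abs]
        gcongr
        exact norm_le_pi_norm f _
    _ = (∑ j, |A (p i) j|) * ‖f‖ := by rw [Finset.sum_mul]
    _ ≤ C * ‖f‖ := by gcongr; exact hA _

/-- A block of integers viewed as a block of reals. -/
def castBlock (f : BlockIdx d → ℤ) : BlockIdx d → ℝ := fun p => (f p : ℝ)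

theorem norm_castBlock_along_sub_le (i : Fin d) (f : BlockIdx d → ℤ) :
    ‖castBlock (along fwdLift i f) - alongMatrix fwdMatrix i (castBlock f)‖ ≤ 3 / 2 :=
  (pi_norm_le_iff_of_nonneg (by norm_num)).2 fun p =>
    abs_fwdLift_sub_le (fun a => f (Function.update p i a)) (p i)

/-- The exact forward pass has norm at most `1`, so earlier errors are not amplified and each pass
adds `3/2`. The second block `h` is free because the integer and exact iterates separate after one
pass. -/
theorem norm_foldl_fwd_sub_le (l : List (Fin d)) (f : BlockIdx d → ℤ) (h : BlockIdx d → ℝ) :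
    ‖castBlock (l.foldl (fun h i => along fwdLift i h) f) -
        l.foldl (fun h i => alongMatrix fwdMatrix i h) h‖ ≤
      ‖castBlock f - h‖ + 3 / 2 * l.length := by
  induction l generalizing f h with
  | nil => simp
  | cons i l ih =>
    refine (ih _ _).trans ?_
    have h1 := norm_castBlock_along_sub_le i f
    have h2 := norm_alongMatrix_le fwdMatrix_row_sum i (castBlock f - h)
    rw [alongMatrix_sub] at h2
    have h3 := norm_sub_le_norm_sub_add_norm_sub (castBlock (along fwdLift i f))
      (alongMatrix fwdMatrix i (castBlock f)) (alongMatrix fwdMatrix i h)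
    simp only [List.length_cons]
    push_cast
    linarith

theorem norm_foldr_inv_sub_le (l : List (Fin d)) (f g : BlockIdx d → ℝ) :
    ‖l.foldr (fun i h => alongMatrix invMatrix i h) f -
        l.foldr (fun i h => alongMatrix invMatrix i h) g‖ ≤ (15 / 4) ^ l.length * ‖f - g‖ := by
  induction l with
  | nil => simp
  | cons i l ih =>
    simp only [List.foldr_cons, List.length_cons, ← alongMatrix_sub]
    refine (norm_alongMatrix_le invMatrix_row_sum i _).trans ?_
    rw [pow_succ']
    linarith

theorem foldr_inv_foldl_fwd (l : List (Fin d)) (f : BlockIdx d → ℝ) :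
    l.foldr (fun i h => alongMatrix invMatrix i h)
      (l.foldl (fun h i => alongMatrix fwdMatrix i h) f) = f := by
  induction l generalizing f with
  | nil => rfl
  | cons i l ih =>
    simp only [List.foldr_cons, List.foldl_cons, ih]
    exact alongMatrix_alongMatrix invMatrix_mul_fwdMatrix i f

/-- Each pass is exact on multiples of `4` and uses up one factor `4`; the spare divisor `m` carries
the remaining factors through the induction. -/
theorem foldr_inv_exact (l : List (Fin d)) (m : ℤ) (f : BlockIdx d → ℤ)
    (hf : ∀ p, 4 ^ l.length * m ∣ f p) :
    (∀ p, m ∣ l.foldr (fun i h => along invLift i h) f p) ∧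
      castBlock (l.foldr (fun i h => along invLift i h) f) =
        l.foldr (fun i h => alongMatrix invMatrix i h) (castBlock f) := by
  induction l generalizing m with
  | nil => exact ⟨by simpa using hf, rfl⟩
  | cons i l ih =>
    obtain ⟨h1, h2⟩ := ih (4 * m) fun p => by
      have := hf p
      rwa [List.length_cons, pow_succ, mul_assoc] at this
    refine ⟨fun p => dvd_invLift m _ (fun a => h1 _) _, ?_⟩
    simp only [List.foldr_cons, ← h2]
    funext p
    exact invLift_eq_mulVec _ (fun a => (Dvd.intro m rfl).trans (h1 _)) (p i)

theorem norm_inv_sub_le (c f : BlockIdx d → ℤ) (hc : ∀ p, 4 ^ d ∣ c p) {δ : ℝ}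
    (h : ‖castBlock c - castBlock (fwdTransform f)‖ ≤ δ) :
    ‖castBlock (invTransform c) - castBlock f‖ ≤ (15 / 4) ^ d * (δ + 3 / 2 * d) := by
  have h1 := (foldr_inv_exact (List.finRange d) 1 c (by simpa using hc)).2
  have h2 := norm_foldl_fwd_sub_le (List.finRange d) f (castBlock f)
  have h3 := norm_foldr_inv_sub_le (List.finRange d) (castBlock c)
    ((List.finRange d).foldl (fun h i => alongMatrix fwdMatrix i h) (castBlock f))
  rw [foldr_inv_foldl_fwd, ← h1] at h3
  simp only [List.length_finRange, sub_self, norm_zero, zero_add] at h2 h3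
  refine h3.trans ?_
  gcongr
  exact (norm_sub_le_norm_sub_add_norm_sub _ (castBlock (fwdTransform f)) _).trans
    (add_le_add h h2)

theorem abs_fwdTransform_le {M : ℤ} (hM : M ≠ 1) (f : BlockIdx d → ℤ) (hf : ∀ p, |f p| ≤ M)
    (p : BlockIdx d) : |fwdTransform f p| ≤ M := by
  unfold fwdTransform
  induction List.finRange d generalizing f with
  | nil => exact hf p
  | cons i l ih => exact ih _ fun p => abs_fwdLift_le hM _ (fun _ => hf _) _

/-! ### Negabinary digits and their truncation -/

theorem sum_negaDigit (z : ℤ) (n : ℕ) :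
    z = ∑ i ∈ Finset.range n, negaDigit z i * (-2) ^ i + (-2) ^ n * negaShift^[n] z := by
  induction n with
  | zero => simp
  | succ n ih =>
    rw [Finset.sum_range_succ, Function.iterate_succ_apply', pow_succ]
    conv_lhs => rw [ih]
    have : negaShift^[n] z = negaDigit z n + (-2) * negaShift (negaShift^[n] z) := by
      unfold negaDigit negaShift
      omega
    conv_lhs => rw [this]
    ring

theorem negaDigit_eq_zero_or_one (z : ℤ) (i : ℕ) : negaDigit z i = 0 ∨ negaDigit z i = 1 :=
  Int.emod_two_eq_zero_or_one _

theorem neg_two_pow_eq_or (n : ℕ) : ((-2 : ℤ)) ^ n = 2 ^ n ∨ ((-2 : ℤ)) ^ n = -2 ^ n := by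
  rcases Nat.even_or_odd n with h | h
  · exact .inl (h.neg_pow 2)
  · exact .inr (Odd.neg_pow h 2)

/-- These are the exact extremes, with all even-indexed or all odd-indexed digits equal to `1`; the
term `(-2) ^ n` covers both parities of `n` in one formula. -/
theorem sum_negaDigit_bounds (z : ℤ) (n : ℕ) :
    6 * ∑ i ∈ Finset.range n, negaDigit z i * (-2) ^ i ≤ 3 * 2 ^ n - (-2) ^ n - 2 ∧
      -(3 * 2 ^ n) - (-2) ^ n + 4 ≤ 6 * ∑ i ∈ Finset.range n, negaDigit z i * (-2) ^ i := by
  induction n with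
  | zero => simp
  | succ n ih =>
    rw [Finset.sum_range_succ, pow_succ, pow_succ]
    have h2 : (0 : ℤ) < 2 ^ n := by positivity
    rcases neg_two_pow_eq_or n with h | h <;> rcases negaDigit_eq_zero_or_one z n with h' | h' <;>
      rw [h'] <;> rw [h] at ih ⊢ <;> constructor <;> linarith [ih.1, ih.2]

/-- A nonzero remainder contributes at least `4 * 2 ^ q` in absolute value, while the `q + 2` digits
cancel at most `8/3 * 2 ^ q`, leaving more than `2 ^ q`. -/
theorem negaShift_iterate_eq_zero (z : ℤ) (q : ℕ) (hz : |z| ≤ 2 ^ q) :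
    negaShift^[q + 2] z = 0 := by
  have h1 := sum_negaDigit z (q + 2)
  obtain ⟨h2, h3⟩ := sum_negaDigit_bounds z (q + 2)
  have h4 : (2 : ℤ) ^ (q + 2) = 4 * 2 ^ q := by ring
  have hq : (0 : ℤ) < 2 ^ q := by positivity
  rw [abs_le] at hz
  set R := negaShift^[q + 2] z
  by_contra hR
  rcases lt_or_gt_of_ne hR with hR | hR
  · have hR : R ≤ -1 := by omega
    rcases neg_two_pow_eq_or (q + 2) with h | h <;> rw [h] at h1 h2 h3 <;> rw [h4] at h1 h2 h3 <;>
      nlinarith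
  · have hR : 1 ≤ R := by omega
    rcases neg_two_pow_eq_or (q + 2) with h | h <;> rw [h] at h1 h2 h3 <;> rw [h4] at h1 h2 h3 <;>
      nlinarith

theorem three_mul_abs_sum_negaDigit_le (z : ℤ) (n : ℕ) :
    3 * |∑ i ∈ Finset.range n, negaDigit z i * (-2) ^ i| ≤ 2 * 2 ^ n := by
  obtain ⟨h2, h3⟩ := sum_negaDigit_bounds z n
  have h : (0 : ℤ) < 2 ^ n := by positivity
  have : |∑ i ∈ Finset.range n, negaDigit z i * (-2) ^ i| * 6 ≤ 4 * 2 ^ n := by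
    rw [← abs_of_pos (by norm_num : (0 : ℤ) < 6), ← abs_mul, abs_le]
    rcases neg_two_pow_eq_or n with h | h <;> rw [h] at h2 h3 <;> constructor <;> linarith
  linarith

/-- The value of the `q + 2` negabinary digits of `z` after the lowest `r` are cleared. -/
def negaTrunc (q r : ℕ) (z : ℤ) : ℤ :=
  ∑ i : Fin (q + 2), if decide (r ≤ (i : ℕ) ∧ negaDigit z i = 1) then (-2 : ℤ) ^ (i : ℕ) else 0

theorem negaTrunc_eq (q r : ℕ) (z : ℤ) :
    negaTrunc q r z =
      ∑ i ∈ Finset.range (q + 2), if r ≤ i then negaDigit z i * (-2) ^ i else 0 := by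
  rw [negaTrunc, ← Fin.sum_univ_eq_sum_range
    (fun i => if r ≤ i then negaDigit z i * (-2) ^ i else 0)]
  refine Finset.sum_congr rfl fun i _ => ?_
  rcases negaDigit_eq_zero_or_one z i with h | h <;> simp [h]

theorem pow_dvd_negaTrunc (q r : ℕ) (z : ℤ) : 2 ^ r ∣ negaTrunc q r z := by
  rw [negaTrunc_eq]
  refine Finset.dvd_sum fun i _ => ?_
  split_ifs with h
  · refine Dvd.dvd.mul_left ?_ _
    rcases neg_two_pow_eq_or i with h' | h' <;> rw [h']
    · exact pow_dvd_pow 2 h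
    · exact (pow_dvd_pow 2 h).neg_right
  · exact dvd_zero _

theorem three_mul_abs_negaTrunc_sub_le {q r : ℕ} (hr : r ≤ q + 2) (z : ℤ) (hz : |z| ≤ 2 ^ q) :
    3 * |negaTrunc q r z - z| ≤ 2 * 2 ^ r := by
  have h1 := sum_negaDigit z (q + 2)
  rw [negaShift_iterate_eq_zero z q hz, mul_zero, add_zero] at h1
  have h2 : z - negaTrunc q r z = ∑ i ∈ Finset.range r, negaDigit z i * (-2) ^ i := by
    rw [negaTrunc_eq]
    nth_rewrite 1 [h1]
    rw [← Finset.sum_sub_distrib, ← Finset.sum_subset (Finset.range_mono hr)]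
    · refine Finset.sum_congr rfl fun i hi => ?_
      rw [if_neg (by simpa using hi), sub_zero]
    · intro i _ hi
      rw [if_pos (by simpa using hi), sub_self]
  rw [abs_sub_comm, h2]
  exact three_mul_abs_sum_negaDigit_le z r

/-! ### Error of one round trip -/

theorem eps_pos (r : ℤ) : 0 < eps r := by unfold eps; positivity

theorem decompress_compress_zero (rnd : RoundingMode) (k q β : ℕ) :
    decompress rnd k (compress q β (0 : BlockIdx d → ℝ)) = 0 := by
  have h0 : blockInts q (0 : BlockIdx d → ℝ) = 0 := by
    funext p
    simp [blockInts, RoundingMode.round]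
  have h1 : ∀ p, fwdTransform (0 : BlockIdx d → ℤ) p = 0 := fun p =>
    abs_nonpos_iff.1 (abs_fwdTransform_le zero_ne_one _ (by simp) p)
  have h2 : invTransform (0 : BlockIdx d → ℤ) = 0 := by
    unfold invTransform
    induction List.finRange d with
    | nil => rfl
    | cons i l ih =>
      rw [List.foldr_cons, ih]
      funext p
      simp only [along, Pi.zero_apply]
      generalize p i = j
      fin_cases j <;> rfl
  have h3 : ∀ i, negaDigit 0 i = 0 := fun i => by
    have : negaShift^[i] 0 = 0 := Function.iterate_fixed (by simp [negaShift]) i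
    simp [negaDigit, this]
  have h4 : (fun _ => 0 : BlockIdx d → ℤ) = 0 := rfl
  funext p
  simp [decompress, compress, h0, h1, h3, h4, h2, flRound]

theorem decompress_compress_apply (rnd : RoundingMode) (k q β : ℕ) (hβ : β ≤ q + 2)
    (u : BlockIdx d → ℝ) (p : BlockIdx d) :
    decompress rnd k (compress q β u) p =
      flRound rnd k ((invTransform (fun r => negaTrunc q (q + 2 - β)
        (fwdTransform (blockInts q u) r)) p : ℝ) * 2 ^ (Int.log 2 ‖u‖ - ((q : ℤ) - 1))) := by
  have h : ∀ i : ℕ, q + 2 ≤ i + β ↔ q + 2 - β ≤ i := fun i => by omega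
  simp only [decompress, compress, negaTrunc, h]

theorem abs_blockInts_lt (q : ℕ) (u : BlockIdx d → ℝ) (hu : u ≠ 0) (p : BlockIdx d) :
    |blockInts q u p| < 2 ^ q := by
  have hN : 0 < ‖u‖ := norm_pos_iff.2 hu
  have h1 : ‖u‖ < (2 : ℝ) ^ (Int.log 2 ‖u‖ + 1) := by
    exact_mod_cast Int.lt_zpow_succ_log_self (b := 2) one_lt_two ‖u‖
  have h2 := abs_round_towardZero_le (u p * 2 ^ ((q : ℤ) - 1 - Int.log 2 ‖u‖))
  have h3 : |u p| ≤ ‖u‖ := norm_le_pi_norm u p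
  rw [abs_mul, abs_of_pos (by positivity : (0 : ℝ) < 2 ^ ((q : ℤ) - 1 - Int.log 2 ‖u‖))] at h2
  have h4 : (2 : ℝ) ^ (Int.log 2 ‖u‖ + 1) * 2 ^ ((q : ℤ) - 1 - Int.log 2 ‖u‖) = 2 ^ q := by
    rw [← zpow_add₀ (two_ne_zero' ℝ), ← zpow_natCast]
    congr 1
    ring
  have h5 : |(blockInts q u p : ℝ)| < 2 ^ q := by
    rw [← h4]
    refine h2.trans_lt ?_
    gcongr
    exact h3.trans_lt h1
  exact_mod_cast h5

theorem abs_fwdTransform_blockInts_le (q : ℕ) (u : BlockIdx d → ℝ) (hu : u ≠ 0)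
    (p : BlockIdx d) : |fwdTransform (blockInts q u) p| ≤ 2 ^ q := by
  -- For `q = 0` the bound `2 ^ q` is the excluded value `1`, but then the block integers all
  -- vanish.
  rcases Nat.eq_zero_or_pos q with rfl | hq
  · have h : ∀ p, |blockInts 0 u p| ≤ 0 := fun p => by
      have := abs_blockInts_lt 0 u hu p
      simp only [pow_zero] at this
      omega
    exact (abs_fwdTransform_le zero_ne_one _ h p).trans (by norm_num)
  · refine abs_fwdTransform_le ?_ _ (fun p => (abs_blockInts_lt q u hu p).le) p
    exact (one_lt_pow₀ (by norm_num) hq.ne').ne'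

/-- Relative error of a block before the final rounding to `k` significant bits. -/
def transformError (d q β : ℕ) : ℝ :=
  (15 / 4) ^ d * (8 / 3 * eps β) + eps q * (1 + (15 / 4) ^ d * (3 / 2 * d))

/-- Relative error of a compressed and decompressed block. -/
def blockError (d k q β : ℕ) : ℝ :=
  (1 + eps k) * transformError d q β + eps k

theorem transformError_nonneg (d q β : ℕ) : 0 ≤ transformError d q β := by
  unfold transformError
  have := eps_pos q
  have := eps_pos β
  positivity

theorem blockError_nonneg (d k q β : ℕ) : 0 ≤ blockError d k q β := by
  unfold blockError
  have := eps_pos k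
  have := transformError_nonneg d q β
  positivity

theorem abs_inv_negaTrunc_sub_le (q β : ℕ) (hβ : β + 2 * d ≤ q + 2) (u : BlockIdx d → ℝ)
    (hu : u ≠ 0) (p : BlockIdx d) :
    |(invTransform (fun r => negaTrunc q (q + 2 - β) (fwdTransform (blockInts q u) r)) p : ℝ) *
        2 ^ (Int.log 2 ‖u‖ - ((q : ℤ) - 1)) - u p| ≤ transformError d q β * ‖u‖ := by
  set c : BlockIdx d → ℤ := fun r => negaTrunc q (q + 2 - β) (fwdTransform (blockInts q u) r)
  -- At least `2 * d` low digits are cleared.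
  have hdvd : ∀ r, 4 ^ d ∣ c r := fun r =>
    (by rw [show (4 : ℤ) = 2 ^ 2 by norm_num, ← pow_mul]; exact pow_dvd_pow 2 (by omega) :
      (4 : ℤ) ^ d ∣ 2 ^ (q + 2 - β)).trans (pow_dvd_negaTrunc _ _ _)
  have hc : ‖castBlock c - castBlock (fwdTransform (blockInts q u))‖ ≤
      2 / 3 * 2 ^ (q + 2 - β) := by
    refine (pi_norm_le_iff_of_nonneg (by positivity)).2 fun r => ?_
    have := three_mul_abs_negaTrunc_sub_le (q := q) (r := q + 2 - β) (by omega) _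
      (abs_fwdTransform_blockInts_le q u hu r)
    rify at this
    simp only [castBlock, Pi.sub_apply, Real.norm_eq_abs]
    linarith
  have h1 : |(invTransform c p : ℝ) - blockInts q u p| ≤
      (15 / 4) ^ d * (2 / 3 * 2 ^ (q + 2 - β) + 3 / 2 * d) :=
    (norm_le_pi_norm _ p).trans (norm_inv_sub_le c _ hdvd hc)
  have h2 : |(blockInts q u p : ℝ) - u p * 2 ^ ((q : ℤ) - 1 - Int.log 2 ‖u‖)| ≤ 1 :=
    RoundingMode.abs_round_sub_le _ _
  set s : ℝ := 2 ^ (Int.log 2 ‖u‖ - ((q : ℤ) - 1))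
  have hs : 0 < s := by positivity
  have hss : (2 : ℝ) ^ ((q : ℤ) - 1 - Int.log 2 ‖u‖) * s = 1 := by
    rw [← zpow_add₀ (two_ne_zero' ℝ)]
    simp
  have hsN : s ≤ eps q * ‖u‖ := by
    have h3 : (2 : ℝ) ^ Int.log 2 ‖u‖ ≤ ‖u‖ := by
      exact_mod_cast Int.zpow_log_le_self (b := 2) one_lt_two (norm_pos_iff.2 hu)
    have h4 : s = eps q * 2 ^ Int.log 2 ‖u‖ := by
      rw [eps, ← zpow_add₀ (two_ne_zero' ℝ)]
      exact congrArg (fun n : ℤ => (2 : ℝ) ^ n)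
        (by ring : Int.log 2 ‖u‖ - ((q : ℤ) - 1) = 1 - q + Int.log 2 ‖u‖)
    rw [h4]
    have := eps_pos q
    gcongr
  have hpow : (2 / 3 * 2 ^ (q + 2 - β)) * eps q = 8 / 3 * eps β := by
    have h : (2 : ℝ) ^ (q + 2 - β) * eps q = 4 * eps β := by
      rw [show (4 : ℝ) = 2 ^ (2 : ℤ) by norm_num, eps, eps, ← zpow_add₀ (two_ne_zero' ℝ),
        ← zpow_natCast, ← zpow_add₀ (two_ne_zero' ℝ), Nat.cast_sub (by omega)]
      congr 1
      push_cast
      ring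
    linarith
  have h5 : (invTransform c p : ℝ) * s - u p =
      ((invTransform c p : ℝ) - u p * 2 ^ ((q : ℤ) - 1 - Int.log 2 ‖u‖)) * s := by
    rw [sub_mul, mul_assoc, hss, mul_one]
  rw [h5, abs_mul, abs_of_pos hs]
  calc _ ≤ ((15 / 4) ^ d * (2 / 3 * 2 ^ (q + 2 - β) + 3 / 2 * d) + 1) * (eps q * ‖u‖) := by
        gcongr
        exact (abs_sub_le _ _ _).trans (add_le_add h1 h2)
    _ = ((15 / 4) ^ d * ((2 / 3 * 2 ^ (q + 2 - β)) * eps q) +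
          eps q * (1 + (15 / 4) ^ d * (3 / 2 * d))) * ‖u‖ := by ring
    _ = _ := by rw [hpow, transformError]

theorem abs_decompress_compress_sub_le (rnd : RoundingMode) (k q β : ℕ)
    (hβ : β + 2 * d ≤ q + 2) (u : BlockIdx d → ℝ) (p : BlockIdx d) :
    |decompress rnd k (compress q β u) p - u p| ≤ blockError d k q β * ‖u‖ := by
  by_cases hu : u = 0
  · subst hu
    simp [decompress_compress_zero]
  rw [decompress_compress_apply rnd k q β (by omega)]
  have h1 := abs_inv_negaTrunc_sub_le q β hβ u hu p
  set v := (invTransform (fun r => negaTrunc q (q + 2 - β) (fwdTransform (blockInts q u) r)) p : ℝ) *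
        2 ^ (Int.log 2 ‖u‖ - ((q : ℤ) - 1))
  have h2 := abs_flRound_sub_le rnd k v
  have h3 : |u p| ≤ ‖u‖ := norm_le_pi_norm u p
  have h4 : |v| ≤ transformError d q β * ‖u‖ + ‖u‖ := by
    have := abs_sub_abs_le_abs_sub v (u p)
    linarith
  have hk := eps_pos k
  calc _ ≤ eps k * (transformError d q β * ‖u‖ + ‖u‖) + transformError d q β * ‖u‖ :=
        (abs_sub_le _ v _).trans (add_le_add (h2.trans (by gcongr)) h1)
    _ = _ := by rw [blockError]; ring

theorem norm_roundTrip_sub_le {m : Fin d → ℕ} (rnd : RoundingMode) (k q β : ℕ)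
    (hβ : β + 2 * d ≤ q + 2) (x : ArrayIdx m → ℝ) :
    ‖roundTrip rnd k q β x - x‖ ≤ blockError d k q β * ‖x‖ := by
  have hE := blockError_nonneg d k q β
  refine (pi_norm_le_iff_of_nonneg (by positivity)).2 fun j => ?_
  set b := fun i => (finProdFinEquiv.symm (j i)).1
  set p : BlockIdx d := fun i => (finProdFinEquiv.symm (j i)).2
  have h1 := abs_decompress_compress_sub_le rnd k q β hβ (block x b) p
  have h2 : block x b p = x j := congrArg x (funext fun i => finProdFinEquiv.apply_symm_apply (j i))
  have h3 : ‖block x b‖ ≤ ‖x‖ :=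
    (pi_norm_le_iff_of_nonneg (norm_nonneg _)).2 fun p => norm_le_pi_norm x _
  rw [h2] at h1
  exact h1.trans (by gcongr)

/-! ### Comparison with the constant `K` -/

theorem K_pos (d k q β : ℕ) : 0 < K d k q β := by
  unfold K kT
  have := eps_pos q
  have := eps_pos β
  have := eps_pos k
  have : (0 : ℝ) ≤ 2 ^ d - 1 := sub_nonneg.2 (one_le_pow₀ (by norm_num))
  positivity

theorem four_pow_mul_eps_le {q β : ℕ} (hβ : β + 2 * d ≤ q + 2) : 4 ^ d * eps q ≤ 4 * eps β := by
  rw [show (4 : ℝ) ^ d = 2 ^ ((2 * d : ℕ) : ℤ) by rw [zpow_natCast, pow_mul]; norm_num,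
    show (4 : ℝ) = 2 ^ (2 : ℤ) by norm_num, eps, eps, ← zpow_add₀ (two_ne_zero' ℝ),
    ← zpow_add₀ (two_ne_zero' ℝ)]
  exact zpow_le_zpow_right₀ one_le_two (by push_cast; omega)

theorem four_mul_le_four_pow (hd : 1 ≤ d) : 4 * (d : ℝ) ≤ 4 ^ d := by
  induction d, hd using Nat.le_induction with
  | base => norm_num
  | succ n hn ih =>
    rw [pow_succ]
    push_cast
    have : (1 : ℝ) ≤ n := by exact_mod_cast hn
    linarith

theorem blockError_le (hd : 1 ≤ d) {k q β : ℕ} (hk : 1 ≤ k) (hβ : β + 2 * d ≤ q + 2) :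
    blockError d k q β ≤ 1 / 3 * K d k q q +
      2 / 3 * ((2 ^ d + 1) * ((15 / 4) ^ d * (8 / 3 * eps β))) := by
  have hw := eps_pos q
  have hw' := four_pow_mul_eps_le hβ
  have ha := eps_pos k
  have ha1 : eps k ≤ 1 := by
    rw [eps]
    exact zpow_le_one_of_nonpos₀ one_le_two (by omega)
  have hP : (15 / 4 : ℝ) ≤ (15 / 4) ^ d := le_self_pow₀ (by norm_num) (by omega)
  have hd1 : (1 : ℝ) ≤ d := by exact_mod_cast hd
  have hT : 2 * (d : ℝ) ≤ 2 ^ d := by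
    exact_mod_cast (by simpa using Nat.mul_le_pow (by norm_num : 2 ≠ 1) d : 2 * d ≤ 2 ^ d)
  -- `d * eps q ≤ eps β` lets the truncation term pay for part of the forward rounding, whose share
  -- grows with `d`.
  have hQ : 8 / 3 * ((15 / 4) ^ d * (d * eps q)) ≤ (15 / 4) ^ d * (8 / 3 * eps β) := by
    have h1 := mul_le_mul_of_nonneg_right (four_mul_le_four_pow hd) hw.le
    have h2 : d * eps q ≤ eps β := by linarith
    have := mul_le_mul_of_nonneg_left h2 (by positivity : (0 : ℝ) ≤ (15 / 4) ^ d)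
    linarith
  -- `11/3 = 8/3 + 1`: what remains of `K` at `β = q` after the higher-order terms in `eps q` are
  -- dropped.
  have hK : (15 / 4) ^ d * ((1 + eps k) * (eps q * (11 / 3 + 7 / 4 * (2 ^ d - 1))) + eps k) ≤
      K d k q q := by
    unfold K kT
    have hT' : (0 : ℝ) ≤ 7 / 4 * (2 ^ d - 1) := by linarith
    have h1 : eps q * (7 / 4 * (2 ^ d - 1) + 1) ≤
        eps q * (1 + 8 / 3 * eps q) * (7 / 4 * (2 ^ d - 1) * (1 + eps q) + 1) := by
      refine mul_le_mul (le_mul_of_one_le_right hw.le (by linarith)) ?_ (by positivity)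
        (by positivity)
      exact add_le_add_left (le_mul_of_one_le_right hT' (by linarith)) 1
    gcongr
    linarith
  have hmain : eps q * (1 + (15 / 4) ^ d * (3 / 2 * d)) ≤
      1 / 3 * ((15 / 4) ^ d * (eps q * (11 / 3 + 7 / 4 * (2 ^ d - 1)))) +
        1 / 3 * (2 ^ d - 2) * ((15 / 4) ^ d * (8 / 3 * eps β)) := by
    have h1 : 1 / 3 * (2 ^ d - 2) * (8 / 3 * ((15 / 4) ^ d * (d * eps q))) ≤
        1 / 3 * (2 ^ d - 2) * ((15 / 4) ^ d * (8 / 3 * eps β)) :=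
      mul_le_mul_of_nonneg_left hQ (by linarith)
    have h2 : eps q ≤ 4 / 15 * ((15 / 4) ^ d * eps q) := by nlinarith
    have h3 : 4 / 15 + 3 / 2 * d ≤
        1 / 3 * (11 / 3 + 7 / 4 * (2 ^ d - 1)) + 8 / 9 * ((2 ^ d - 2) * (d : ℝ)) := by
      have : (2 ^ d - 2) * (1 : ℝ) ≤ (2 ^ d - 2) * (d : ℝ) :=
        mul_le_mul_of_nonneg_left hd1 (by linarith)
      linarith
    have h4 := mul_le_mul_of_nonneg_left h3 (by positivity : 0 ≤ (15 / 4) ^ d * eps q)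
    linarith
  unfold blockError transformError
  generalize (15 / 4 : ℝ) ^ d * (8 / 3 * eps β) = Q at *
  have hQ0 : 0 ≤ Q := le_trans (by positivity) hQ
  have h1 := mul_le_mul_of_nonneg_left hmain (by linarith : 0 ≤ 1 + eps k)
  -- Since `1 + (2 ^ d - 2) / 3 = (2 ^ d + 1) / 3`, the right side is exactly the `2/3` share in the
  -- claim.
  have h2 : (1 + eps k) * Q * (1 + 1 / 3 * (2 ^ d - 2)) ≤ 2 * Q * (1 + 1 / 3 * (2 ^ d - 2)) := by
    gcongr
    · linarith
    · linarith
  have h3 : eps k ≤ 1 / 3 * ((15 / 4) ^ d * eps k) := by nlinarith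
  linarith

/-! ### Error propagation and the final bound -/

theorem error_recursion {L : ℝ} (hL : 0 ≤ L) (hL1 : L < 1) {C : ℝ} {t : ℕ} {e : ℕ → ℝ}
    (h0 : e 0 ≤ 0) (he : ∀ s ≤ t, e (s + 1) ≤ L * (C + e s)) (s : ℕ) (hs : s ≤ t + 1) :
    (1 - L) * e s ≤ C * L * (1 - L ^ s) := by
  induction s with
  | zero => simpa using mul_nonpos_of_nonneg_of_nonpos (sub_nonneg.2 hL1.le) h0
  | succ s ih =>
    calc (1 - L) * e (s + 1) ≤ (1 - L) * (L * (C + e s)) :=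
          mul_le_mul_of_nonneg_left (he s (by omega)) (sub_nonneg.2 hL1.le)
      _ = (1 - L) * (L * C) + L * ((1 - L) * e s) := by ring
      _ ≤ (1 - L) * (L * C) + L * (C * L * (1 - L ^ s)) := by
          exact add_le_add_right (mul_le_mul_of_nonneg_left (ih (by omega)) hL) _
      _ = _ := by rw [pow_succ]; ring

theorem eps_le_of_logb_le {b c : ℝ} {n : ℕ} (hc : 0 < c) (h : 1 - Real.logb 2 c ≤ b)
    (hb : b ≤ n) : eps n ≤ c := by
  rw [eps, ← Real.rpow_intCast]
  refine (Real.le_logb_iff_rpow_le one_lt_two hc).1 ?_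
  push_cast
  linarith

end ZFP

end

theorem lemma3p2
    (d k q : ℕ) (hd : 1 ≤ d) (hk : 1 ≤ k) (rnd : ZFP.RoundingMode) (m : Fin d → ℕ)
    (g : (ZFP.ArrayIdx m → ℝ) → (ZFP.ArrayIdx m → ℝ)) (L : ℝ≥0)
    (hg : LipschitzWith L g) (hL : L < 1)
    -- the numbers of bit planes kept, in the range where the backward transform is lossless
    (t : ℕ) (β : ℕ → ℕ) (hβ : ∀ j ≤ t, β j + 2 * d ≤ q + 2)
    (x y : ℕ → ZFP.ArrayIdx m → ℝ) (h0 : x 0 = y 0)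
    (hx : ∀ s, x (s + 1) = g (ZFP.roundTrip rnd k q (β s) (x s)))
    (hy : ∀ s, y (s + 1) = g (y s))
    (γ : ℝ)
    (hγ : γ = (Finset.range (t + 1)).sup' Finset.nonempty_range_add_one (fun j => ‖x j‖))
    (ε : ℝ) (hε : ZFP.K d k q q * γ / (1 - L) ≤ ε)
    (βmin : ℝ)
    -- for `γ = 0` or `L = 0` the lower bound is `-∞`
    (hβmin : γ * L ≠ 0 → 1 - Real.logb 2 ((4 / 15) ^ d *
      (3 * ε * (1 - L) / (8 * γ * (2 ^ d + 1) * L * (1 - (L : ℝ) ^ (t + 2))))) ≤ βmin)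
    (hβj : ∀ j ≤ t, βmin ≤ β j) :
    ‖x (t + 1) - y (t + 1)‖ ≤ ε := by
  have hL0 : (0 : ℝ) ≤ L := L.2
  have hL1 : (L : ℝ) < 1 := by exact_mod_cast hL
  have hxγ : ∀ j ≤ t, ‖x j‖ ≤ γ := fun j hj => by
    rw [hγ]
    exact Finset.le_sup' (fun j => ‖x j‖) (Finset.mem_range.2 (by omega))
  have hγ0 : 0 ≤ γ := (norm_nonneg _).trans (hxγ 0 (Nat.zero_le _))
  have hK := ZFP.K_pos d k q q
  rw [div_le_iff₀ (sub_pos.2 hL1)] at hε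
  have hLt : (L : ℝ) ^ (t + 2) < 1 := pow_lt_one₀ hL0 hL1 (by omega)
  have hLt1 : (L : ℝ) ^ (t + 1) ≤ 1 := pow_le_one₀ hL0 hL1.le
  -- it suffices to bound the error committed in every single step
  suffices hstep : ∀ j ≤ t,
      ZFP.blockError d k q (β j) * γ * L * (1 - (L : ℝ) ^ (t + 2)) ≤ ε * (1 - L) by
    -- The largest error per step that `hstep` allows. The geometric sum has `1 - L ^ (t + 1)`,
    -- which is below the `1 - L ^ (t + 2)` used here.
    set C := ε * (1 - L) / (L * (1 - (L : ℝ) ^ (t + 2))) with hC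
    have hrec : ∀ s, ‖x (s + 1) - y (s + 1)‖ ≤
        L * (‖ZFP.roundTrip rnd k q (β s) (x s) - x s‖ + ‖x s - y s‖) := fun s => by
      rw [hx, hy]
      refine (hg.norm_sub_le _ _).trans ?_
      gcongr
      exact norm_sub_le_norm_sub_add_norm_sub _ _ _
    have hε0 : 0 ≤ ε := by
      by_contra h
      nlinarith [mul_nonneg hK.le hγ0]
    -- For `L = 0` the denominator of `C` vanishes, but `g` is constant and the error is zero.
    rcases hL0.eq_or_lt with hLz | hLz
    · have := hrec t
      rw [← hLz, zero_mul] at this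
      exact this.trans hε0
    have hden : 0 < L * (1 - (L : ℝ) ^ (t + 2)) := mul_pos hLz (by linarith)
    have hC0 : 0 ≤ C := div_nonneg (mul_nonneg hε0 (by linarith)) hden.le
    have h := ZFP.error_recursion hL0 hL1 (C := C) (t := t) (e := fun s => ‖x s - y s‖)
      (by simp [h0]) (fun s hs => (hrec s).trans (by
        gcongr
        refine (ZFP.norm_roundTrip_sub_le rnd k q (β s) (hβ s hs) (x s)).trans ?_
        rw [hC, le_div_iff₀ hden]
        refine le_trans ?_ (hstep s hs)
        rw [← mul_assoc]
        have := ZFP.blockError_nonneg d k q (β s)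
        have : 0 ≤ 1 - (L : ℝ) ^ (t + 2) := by linarith
        gcongr
        exact hxγ s hs)) (t + 1) le_rfl
    have h' : C * L * (1 - (L : ℝ) ^ (t + 1)) ≤ ε * (1 - L) := by
      calc C * L * (1 - (L : ℝ) ^ (t + 1)) ≤ C * L * (1 - (L : ℝ) ^ (t + 2)) := by
            gcongr C * L * (1 - ?_)
            exact pow_le_pow_of_le_one hL0 hL1.le (by omega)
        _ = ε * (1 - L) := by rw [mul_assoc, hC, div_mul_cancel₀ _ hden.ne']
    have h1 : (1 - (L : ℝ)) * ‖x (t + 1) - y (t + 1)‖ ≤ (1 - L) * ε := by linarith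
    exact le_of_mul_le_mul_left h1 (sub_pos.2 hL1)
  intro j hj
  by_cases hγL : γ * L = 0
  · have h1 : ZFP.blockError d k q (β j) * γ * L * (1 - (L : ℝ) ^ (t + 2)) = 0 := by
      rw [mul_assoc _ γ, hγL]
      ring
    rw [h1]
    exact (mul_nonneg hK.le hγ0).trans hε
  have hγpos : 0 < γ := hγ0.lt_of_ne fun h => hγL (by rw [← h, zero_mul])
  have hLpos : 0 < (L : ℝ) := hL0.lt_of_ne fun h => hγL (by rw [← h, mul_zero])
  have hεL : 0 < ε * (1 - L) := (mul_pos hK hγpos).trans_le hε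
  have h1L : 0 < 1 - (L : ℝ) ^ (t + 2) := by linarith
  have hden : 0 < 8 * γ * (2 ^ d + 1) * L * (1 - (L : ℝ) ^ (t + 2)) := by positivity
  have heps := ZFP.eps_le_of_logb_le
    (mul_pos (by positivity) (div_pos (by linarith) hden)) (hβmin hγL) (hβj j hj)
  have hQ : (2 ^ d + 1) * ((15 / 4) ^ d * (8 / 3 * ZFP.eps (β j))) *
      (γ * L * (1 - (L : ℝ) ^ (t + 2))) ≤ ε * (1 - L) := by
    rw [← mul_div_assoc, le_div_iff₀ hden] at heps
    have h1 := mul_le_mul_of_nonneg_left heps (by positivity : (0 : ℝ) ≤ (15 / 4) ^ d)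
    rw [← mul_assoc ((15 / 4 : ℝ) ^ d) ((4 / 15) ^ d), ← mul_pow] at h1
    norm_num at h1
    linarith
  -- With `hQ`, both terms of `blockError_le` are now at most `ε * (1 - L)`, and the weights `1/3`
  -- and `2/3` add up to `1`.
  have hKε : ZFP.K d k q q * (γ * L * (1 - (L : ℝ) ^ (t + 2))) ≤ ε * (1 - L) := by
    refine le_trans ?_ hε
    gcongr
    rw [mul_assoc]
    exact mul_le_of_le_one_right hγ0
      (mul_le_one₀ hL1.le h1L.le (sub_le_self _ (pow_nonneg hL0 _)))
  have hE := mul_le_mul_of_nonneg_right (ZFP.blockError_le hd hk (hβ j hj))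
    (by positivity : 0 ≤ γ * L * (1 - (L : ℝ) ^ (t + 2)))
  linarith
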